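/- Two parties hold devices with inputs $x,y\in\{0,1\}$ and outputs $a,b\in\{0,1\}$; for correlations $P=(p(ab|xy))$ put $\langle A_xB_y\rangle=\sum_{a,b}(-1)^{a+b}p(ab|xy)$ and $I_{\mathrm{CHSH}}=\langle A_0B_0\rangle+\langle A_0B_1\rangle+\langle A_1B_0\rangle-\langle A_1B_1\rangle$. A quantum strategy consists of finite-dimensional Hilbert spaces for Alice, Bob and Eve, a pure state of the three systems (Eve purifies the state of the devices), and two-outcome projective measurements for each input of Alice and of Bob. It generates correlations by the Born rule, and $H(A|X=x,E)$ is the conditional von Neumann entropy of Alice's output given Eve's system; correlations generated in this way are called quantum. For $\theta,\phi,\omega\in\mathbb R$ let $$\langle B_{\theta,\phi,\omega}\rangle=\cos(\theta+\phi)\cos(\theta+\omega)\big(\cos\omega\,\langle A_0B_0\rangle-\cos\phi\,\langle A_0B_1\rangle\big)+\cos\phi\cos\omega\big(-\cos(\theta+\omega)\langle A_1B_0\rangle+\cos(\theta+\phi)\langle A_1B_1\rangle\big),$$ let $\eta^{\mathrm Q}_{\theta,\phi,\omega}=\sin\theta\,\sin(\omega-\phi)\,\sin(\theta+\omega+\phi)$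 be its quantum bound, and consider the sign condition $$\cos(\theta+\phi)\cos(\phi)\cos(\theta+\omega)\cos(\omega)<0.\qquad(*)$$ For observed correlations $P$ with $\langle B_{\theta,\phi,\omega}\rangle=\eta$, the key rate for the key generation inputs $(x,y)$ is $$R^{(x,y)}_{\theta,\phi,\omega}(\eta)=\inf H(A|X=x,E)-H(A|X=x,Y=y,B),$$ where the infimum is over all quantum strategies with $\langle B_{\theta,\phi,\omega}\rangle=\eta$ and the second term is the conditional Shannon entropy in $P$. Logarithms are to base $2$. Let $s\in(2,5/2]$. For every $\epsilon\in(0,2-\tfrac34\log_2 3]$ there exist $(\theta,\phi,\omega)$ satisfying $(*)$ and quantum correlations with $\langle B_{\theta,\phi,\omega}\rangle=\eta^{\mathrm Q}_{\theta,\phi,\omega}$ and $I_{\mathrm{CHSH}}=s$ for which the key rate with key generation inputs $x=y=0$ is $$R^{(0,0)}_{\theta,\phi,\omega}(\eta^{\mathrm Q}_{\theta,\phi,\omega})=1-\epsilon .$$ In particular $\max_{x,y}R^{(x,y)}_{\theta,\phi,\omega}(\eta^{\mathrm Q}_{\theta,\phi,\omega})\ge 1-\epsilon$. Moreover there is $\epsilon_0>0$,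 depending only on $s$, such that for $\epsilon\le\epsilon_0$ the parameters and correlations can be chosen so that also $\max_{x,y}R^{(x,y)}_{\theta,\phi,\omega}(\eta^{\mathrm Q}_{\theta,\phi,\omega})=1-\epsilon$. -/

import Mathlib

open scoped Matrix Kronecker

noncomputable section

namespace DIQKD

/-! ## Behaviours in the Bell scenario with binary inputs and outputs -/

/-- A table of numbers `P x y a b`, read as `p(ab|xy)`. -/
abbrev Behaviour : Type := Fin 2 → Fin 2 → Fin 2 → Fin 2 → ℝ

/-- The correlator `⟨A_x B_y⟩ = ∑_{ab} (-1)^(a+b) p(ab|xy)`. -/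
def correlator (P : Behaviour) (x y : Fin 2) : ℝ :=
  ∑ a : Fin 2, ∑ b : Fin 2, (-1 : ℝ) ^ ((a : ℕ) + (b : ℕ)) * P x y a b

/-- The CHSH value `⟨A₀(B₀ + B₁)⟩ + ⟨A₁(B₀ - B₁)⟩`. -/
def chsh (P : Behaviour) : ℝ :=
  correlator P 0 0 + correlator P 0 1 + correlator P 1 0 - correlator P 1 1

/-- The value of the Bell expression `⟨B_{θ,φ,ω}⟩`. -/
def bellValue (θ φ ω : ℝ) (P : Behaviour) : ℝ :=
  Real.cos (θ + φ) * Real.cos (θ + ω) *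
      (Real.cos ω * correlator P 0 0 - Real.cos φ * correlator P 0 1) +
    Real.cos φ * Real.cos ω *
      (-Real.cos (θ + ω) * correlator P 1 0 + Real.cos (θ + φ) * correlator P 1 1)

/-- The sign condition on the parameters. -/
def SignCondition (θ φ ω : ℝ) : Prop :=
  Real.cos (θ + φ) * Real.cos φ * Real.cos (θ + ω) * Real.cos ω < 0

/-- The quantum bound `η^Q_{θ,φ,ω} = sin θ sin(ω - φ) sin(θ + ω + φ)`. -/
def etaQ (θ φ ω : ℝ) : ℝ :=
  Real.sin θ * Real.sin (ω - φ) * Real.sin (θ + ω + φ)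

/-! ## Entropies (in bits) -/

/-- The von Neumann entropy `-Tr[ρ log₂ ρ]` of a Hermitian matrix; the real function
`t ↦ t log₂ t` (with value `0` at `0`) is applied through the functional calculus. -/
def vonNeumannEntropy {n : Type*} [Fintype n] [DecidableEq n] (ρ : Matrix n n ℂ) : ℝ :=
  -(Matrix.trace (cfc (fun t : ℝ => t * Real.logb 2 t) ρ)).re

/-- The conditional Shannon entropy `H(A|B) = H(AB) - H(B)` of a joint distribution
`p a b` of two bits. -/
def condShannon (p : Fin 2 → Fin 2 → ℝ) : ℝ :=
  (-∑ a : Fin 2, ∑ b : Fin 2, p a b * Real.logb 2 (p a b)) -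
    (-∑ b : Fin 2, (∑ a : Fin 2, p a b) * Real.logb 2 (∑ a : Fin 2, p a b))

/-- The partial trace over the first tensor factor. -/
def partialTraceLeft {m n : Type*} [Fintype m] (X : Matrix (m × n) (m × n) ℂ) :
    Matrix n n ℂ :=
  Matrix.of fun k l => ∑ i : m, X (i, k) (i, l)

/-! ## Quantum strategies, including the purifying system of the adversary -/

/-- A quantum strategy: a unit vector `ψ` in `ℂ^dA ⊗ ℂ^dB ⊗ ℂ^dE`, which is a purification, held
by Eve, of the state shared by the two devices, and two-outcome projective measurements
`M x`, `N y` on the two local spaces. -/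
structure Strategy where
  dA : ℕ
  dB : ℕ
  dE : ℕ
  ψ : (Fin dA × Fin dB) × Fin dE → ℂ
  ψ_unit : ∑ i, ‖ψ i‖ ^ 2 = 1
  M : Fin 2 → Fin 2 → Matrix (Fin dA) (Fin dA) ℂ
  M_proj : ∀ x a, IsStarProjection (M x a)
  M_sum : ∀ x, ∑ a, M x a = 1
  N : Fin 2 → Fin 2 → Matrix (Fin dB) (Fin dB) ℂ
  N_proj : ∀ y b, IsStarProjection (N y b)
  N_sum : ∀ y, ∑ b, N y b = 1

namespace Strategy

variable (S : Strategy)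

/-- The projector `|ψ⟩⟨ψ|` on the global state. -/
def globalState :
    Matrix ((Fin S.dA × Fin S.dB) × Fin S.dE) ((Fin S.dA × Fin S.dB) × Fin S.dE) ℂ :=
  Matrix.vecMulVec S.ψ (star S.ψ)

/-- The Born rule `p(ab|xy) = Tr[(M_{a|x} ⊗ N_{b|y} ⊗ 1) |ψ⟩⟨ψ|]`. -/
def behaviour : Behaviour := fun x y a b =>
  (Matrix.trace
    (((S.M x a ⊗ₖ S.N y b) ⊗ₖ (1 : Matrix (Fin S.dE) (Fin S.dE) ℂ)) * S.globalState)).re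

/-- Eve's reduced state `ρ_E`. -/
def eveState : Matrix (Fin S.dE) (Fin S.dE) ℂ := partialTraceLeft S.globalState

/-- The subnormalized state `ρ_E^{a|x}` of Eve when Alice's input is `x` and her output `a`. -/
def eveCondState (x a : Fin 2) : Matrix (Fin S.dE) (Fin S.dE) ℂ :=
  partialTraceLeft
    (((S.M x a ⊗ₖ (1 : Matrix (Fin S.dB) (Fin S.dB) ℂ)) ⊗ₖ
      (1 : Matrix (Fin S.dE) (Fin S.dE) ℂ)) * S.globalState)

/-- The classical-quantum state `ρ_{AE|X=x} = ∑_a |a⟩⟨a| ⊗ ρ_E^{a|x}`, as a matrix that is block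
diagonal over the value of Alice's output. -/
def cqState (x : Fin 2) : Matrix (Fin S.dE × Fin 2) (Fin S.dE × Fin 2) ℂ :=
  Matrix.blockDiagonal fun a => S.eveCondState x a

/-- The conditional von Neumann entropy `H(A|X=x,E) = H(AE) - H(E)` of `ρ_{AE|X=x}`. -/
def condEntropyEve (x : Fin 2) : ℝ :=
  vonNeumannEntropy (S.cqState x) - vonNeumannEntropy S.eveState

end Strategy

/-- Quantum correlations: behaviours that some quantum strategy generates. -/
def IsQuantum (P : Behaviour) : Prop := ∃ S : Strategy, S.behaviour = P

/-! ## Key rates -/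

/-- The infimum of `H(A|X=x,E)` over all quantum strategies compatible with the value `η` of
`⟨B_{θ,φ,ω}⟩`. -/
def certifiedEntropy (θ φ ω η : ℝ) (x : Fin 2) : ℝ :=
  sInf {h : ℝ | ∃ S : Strategy, bellValue θ φ ω S.behaviour = η ∧ S.condEntropyEve x = h}

/-- The Devetak-Winter rate `inf H(A|X=x,E) - H(A|X=x,Y=y,B)` of a protocol with key generation
inputs `x`, `y`: Eve's strategies are constrained by the value `η` of `⟨B_{θ,φ,ω}⟩`, and the
second term is computed from the observed correlations `P`. -/
def keyRateAt (θ φ ω η : ℝ) (P : Behaviour) (x y : Fin 2) : ℝ :=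
  certifiedEntropy θ φ ω η x - condShannon (P x y)

/-- The largest of these rates over the choices of key generation inputs. -/
def keyRateMax (θ φ ω η : ℝ) (P : Behaviour) : ℝ :=
  Finset.univ.sup' Finset.univ_nonempty
    (fun i : Fin 2 × Fin 2 => keyRateAt θ φ ω η P i.1 i.2)

end DIQKD

end

/-!
The family of parameters `θ = -(a + t)`, `φ = π/2 + a`, `ω = π/2 - t` suffices. On it the quantum bound
is attained by two maximally entangled qubits with correlators `cos a`, `cos t`, `cos t`,
`cos (a + 2t)` and uniform marginals, so the error term for inputs `(0, 0)` is the binary entropy of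
`(1 + cos a) / 2`, and the CHSH value is `cos a + 2 cos t - cos (a + 2t)`. The angle `a ∈ (0, π/3]` is
chosen to make the error term equal to `ε`, and then `t` to make the CHSH value equal to `s`
(`exists_chsh_angle`). If `ε` is small in terms of `s - 2`, then `a ≤ t` (`le_of_chsh_eq`), so
`(0, 0)` has the strongest correlator and no other pair of inputs gives a better rate.

It remains to see that every strategy at the quantum bound has `H(A|X=x,E) = 1`. The gap between the
quantum bound and the Bell operator is a positive combination of two squares
(`expect_alice_mul_eq_zero`). At the bound both squared operators annihilate the state `ψ`, so on `ψ`
Alice's observables `A₀, A₁` are real combinations of Bob's, and their anticommutator acts as a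
scalar. Hence `A₀` anticommutes on `ψ` with a combination `W` of `A₀` and `A₁` that squares to a
positive scalar and that can be moved to Bob's side; conjugation by `W` flips the sign of
`⟨ψ|A₀ ⊗ Z|ψ⟩`, for every operator `Z` of Eve (`expect_mul_eq_zero_of_anticomm`), and likewise for
`A₁`. So Eve's state conditioned on either outcome is half her reduced state, and the conditional
entropy is one bit (`vonNeumannEntropy_half_copies`). No reduction to qubits is needed.
-/

namespace DIQKD

/-! ### Vector states and the sum-of-squares decomposition -/

section VectorState

variable {ι : Type*} [Fintype ι]

/-- The expectation value `⟨ψ|X|ψ⟩`. -/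
def expect (ψ : ι → ℂ) (X : Matrix ι ι ℂ) : ℂ := star ψ ⬝ᵥ X *ᵥ ψ

lemma expect_mul (ψ : ι → ℂ) (X Y : Matrix ι ι ℂ) :
    expect ψ (X * Y) = star (Xᴴ *ᵥ ψ) ⬝ᵥ (Y *ᵥ ψ) := by
  rw [expect, Matrix.star_mulVec, Matrix.conjTranspose_conjTranspose, ← Matrix.mulVec_mulVec,
    Matrix.dotProduct_mulVec]

lemma expect_add (ψ : ι → ℂ) (X Y : Matrix ι ι ℂ) :
    expect ψ (X + Y) = expect ψ X + expect ψ Y := by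
  simp [expect, Matrix.add_mulVec]

lemma expect_sub (ψ : ι → ℂ) (X Y : Matrix ι ι ℂ) :
    expect ψ (X - Y) = expect ψ X - expect ψ Y := by
  simp [expect, Matrix.sub_mulVec]

lemma expect_smul (ψ : ι → ℂ) (r : ℝ) (X : Matrix ι ι ℂ) :
    expect ψ (r • X) = r * expect ψ X := by
  simp [expect, Matrix.smul_mulVec]

open scoped ComplexOrder in
lemma expect_sq_nonneg (ψ : ι → ℂ) {X : Matrix ι ι ℂ} (hX : X.IsHermitian) :
    0 ≤ expect ψ (X * X) := by
  rw [expect_mul, hX.eq]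
  exact dotProduct_star_self_nonneg _

open scoped ComplexOrder in
lemma mulVec_eq_zero_of_expect_sq (ψ : ι → ℂ) {X : Matrix ι ι ℂ} (hX : X.IsHermitian)
    (h : (expect ψ (X * X)).re = 0) : X *ᵥ ψ = 0 := by
  have h0 : expect ψ (X * X) = 0 :=
    Complex.ext h (Complex.nonneg_iff.1 (expect_sq_nonneg ψ hX)).2.symm
  rw [expect_mul, hX.eq] at h0
  exact dotProduct_star_self_eq_zero.1 h0

lemma expect_trace (ψ : ι → ℂ) (X : Matrix ι ι ℂ) :
    (X * Matrix.vecMulVec ψ (star ψ)).trace = expect ψ X := by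
  rw [Matrix.mul_vecMulVec, Matrix.trace_vecMulVec, dotProduct_comm, expect]

lemma isHermitian_smul {ι : Type*} {X : Matrix ι ι ℂ} (hX : X.IsHermitian) (r : ℝ) :
    (r • X).IsHermitian := by
  rw [Matrix.IsHermitian, Matrix.conjTranspose_smul, hX.eq, star_trivial]

variable [DecidableEq ι]

/-- Suppose that `A` and `A'` are reflections whose anticommutator acts on `ψ` as a scalar `κ ≠ ±2`,
and that on `ψ` both can be replaced by Hermitian operators `C`, `C'` commuting with them. Then
`⟨A Z⟩ = 0` for every `Z` commuting with all these operators: the operator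
`W = 2A' - κA` anticommutes with `A` on `ψ`, satisfies `W²ψ = (4 - κ²)ψ`, and moving one factor `W`
around `A Z W W` reverses the sign of the expectation. -/
lemma expect_mul_eq_zero_of_anticomm {ψ : ι → ℂ} {A A' C C' Z : Matrix ι ι ℂ} {κ : ℝ}
    (hκ : κ ^ 2 ≠ 4) (hA : A.IsHermitian) (hA' : A'.IsHermitian)
    (hC : C.IsHermitian) (hC' : C'.IsHermitian)
    (hA2 : A * A = 1) (hA'2 : A' * A' = 1) (hanti : (A * A' + A' * A) *ᵥ ψ = κ • ψ)
    (hAC : A *ᵥ ψ = C *ᵥ ψ) (hAC' : A' *ᵥ ψ = C' *ᵥ ψ)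
    (cAC : Commute A C) (cAC' : Commute A C') (cA'C : Commute A' C) (cA'C' : Commute A' C')
    (cZA : Commute Z A) (cZA' : Commute Z A') (cZC : Commute Z C) (cZC' : Commute Z C') :
    expect ψ (A * Z) = 0 := by
  set W : Matrix ι ι ℂ := (2 : ℝ) • A' - κ • A with hWdef
  set D : Matrix ι ι ℂ := (2 : ℝ) • C' - κ • C with hDdef
  have hW : W.IsHermitian := (isHermitian_smul hA' _).sub (isHermitian_smul hA _)
  have hD : D.IsHermitian := (isHermitian_smul hC' _).sub (isHermitian_smul hC _)
  have hWD : W *ᵥ ψ = D *ᵥ ψ := by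
    simp only [hWdef, hDdef, Matrix.sub_mulVec, Matrix.smul_mulVec, hAC, hAC']
  have cAD : Commute A D := (cAC'.smul_right _).sub_right (cAC.smul_right _)
  have cZD : Commute Z D := (cZC'.smul_right _).sub_right (cZC.smul_right _)
  have cZW : Commute Z W := (cZA'.smul_right _).sub_right (cZA.smul_right _)
  have cWD : Commute W D :=
    ((((cA'C'.smul_right _).sub_right (cA'C.smul_right _)).smul_left _)).sub_left
      (cAD.smul_left _)
  have hWW : (W * W) *ᵥ ψ = (4 - κ ^ 2) • ψ := by
    have : W * W = (4 + κ ^ 2) • (1 : Matrix ι ι ℂ) - (2 * κ) • (A * A' + A' * A) := by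
      simp only [hWdef, sub_mul, mul_sub, smul_mul_assoc, mul_smul_comm, hA2, hA'2]
      module
    rw [this, Matrix.sub_mulVec, Matrix.smul_mulVec, Matrix.smul_mulVec, hanti,
      Matrix.one_mulVec]
    module
  have hWA : (A * W) *ᵥ ψ = -((W * A) *ᵥ ψ) := by
    rw [← sub_eq_zero, sub_neg_eq_add, ← Matrix.add_mulVec]
    have : A * W + W * A = (2 : ℝ) • (A * A' + A' * A) - (2 * κ) • (1 : Matrix ι ι ℂ) := by
      simp only [hWdef, sub_mul, mul_sub, smul_mul_assoc, mul_smul_comm, hA2]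
      module
    rw [this, Matrix.sub_mulVec, Matrix.smul_mulVec, Matrix.smul_mulVec, hanti,
      Matrix.one_mulVec]
    module
  have h1 : expect ψ (A * Z * (W * W)) = (4 - κ ^ 2 : ℝ) * expect ψ (A * Z) := by
    simp only [expect]
    rw [← Matrix.mulVec_mulVec, hWW, Matrix.mulVec_smul, dotProduct_smul, Complex.real_smul]
  have h2 : expect ψ (A * Z * (W * W)) = expect ψ (D * (A * W * Z)) := by
    have e : A * Z * W * D = D * (A * W * Z) := by
      rw [mul_assoc A Z W, cZW.eq, ← mul_assoc A W Z]
      exact (((cAD.mul_left cWD).mul_left cZD)).eq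
    simp only [expect]
    rw [← e, ← mul_assoc, ← Matrix.mulVec_mulVec, ← Matrix.mulVec_mulVec ψ _ D, hWD]
  have h3 : expect ψ (D * (A * W * Z)) = -expect ψ (A * Z * (W * W)) := by
    rw [expect_mul, hD.eq, ← hWD]
    have e : star (W *ᵥ ψ) ⬝ᵥ ((A * W * Z) *ᵥ ψ) = expect ψ ((W * A) * (W * Z)) := by
      rw [mul_assoc W A, ← mul_assoc A W Z, expect_mul, hW.eq]
    have e' : A * Z * (W * W) = (A * W) * (W * Z) := by
      rw [mul_assoc A Z, (cZW.mul_right cZW).eq]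
      simp only [mul_assoc]
    rw [e, e', expect_mul, expect_mul, Matrix.conjTranspose_mul, Matrix.conjTranspose_mul,
      hW.eq, hA.eq, hWA, star_neg, neg_dotProduct]
  have h4 : ((2 * (4 - κ ^ 2) : ℝ) : ℂ) * expect ψ (A * Z) = 0 := by
    push_cast at h1 ⊢
    linear_combination (-2) * h1 + h2 + h3
  refine (mul_eq_zero.1 h4).resolve_left ?_
  intro h
  exact hκ (by linarith [Complex.ofReal_eq_zero.1 h])

/-- If reflections `A₀, A₁` and `B₀, B₁` on the two sides reach the maximum `c (p + q)` of
`q t ⟨A₀B₀⟩ + p q (⟨A₀B₁⟩ + ⟨A₁B₀⟩) - p t ⟨A₁B₁⟩`, where `c² = t² + p q`, then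
`⟨A₀ Z⟩ = ⟨A₁ Z⟩ = 0` for every `Z` acting on a third system.
The gap to the maximum is, up to the factor `2c`, the expectation of
`q (c B₀ - t A₀ - p A₁)² + p (c B₁ - q A₀ + t A₁)²`. -/
lemma expect_alice_mul_eq_zero {ψ : ι → ℂ} {A₀ A₁ B₀ B₁ Z : Matrix ι ι ℂ} {p q t c : ℝ}
    (hp : 0 < p) (hq : 0 < q) (ht : 0 < t) (hc : 0 < c) (hrel : c ^ 2 = t ^ 2 + p * q)
    (hne : (q - p) ^ 2 ≠ 4 * t ^ 2) (hψ : star ψ ⬝ᵥ ψ = 1)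
    (hA₀ : A₀.IsHermitian) (hA₁ : A₁.IsHermitian) (hB₀ : B₀.IsHermitian) (hB₁ : B₁.IsHermitian)
    (sA₀ : A₀ * A₀ = 1) (sA₁ : A₁ * A₁ = 1) (sB₀ : B₀ * B₀ = 1) (sB₁ : B₁ * B₁ = 1)
    (c00 : Commute A₀ B₀) (c01 : Commute A₀ B₁) (c10 : Commute A₁ B₀) (c11 : Commute A₁ B₁)
    (cA₀ : Commute Z A₀) (cA₁ : Commute Z A₁) (cB₀ : Commute Z B₀) (cB₁ : Commute Z B₁)
    (hmax : q * t * (expect ψ (A₀ * B₀)).re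
      + p * q * ((expect ψ (A₀ * B₁)).re + (expect ψ (A₁ * B₀)).re)
      - p * t * (expect ψ (A₁ * B₁)).re = c * (p + q)) :
    expect ψ (A₀ * Z) = 0 ∧ expect ψ (A₁ * Z) = 0 := by
  set X₀ : Matrix ι ι ℂ := c • B₀ - t • A₀ - p • A₁ with hX₀
  set X₁ : Matrix ι ι ℂ := c • B₁ - q • A₀ + t • A₁ with hX₁
  have herm₀ : X₀.IsHermitian :=
    ((isHermitian_smul hB₀ _).sub (isHermitian_smul hA₀ _)).sub (isHermitian_smul hA₁ _)
  have herm₁ : X₁.IsHermitian :=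
    ((isHermitian_smul hB₁ _).sub (isHermitian_smul hA₀ _)).add (isHermitian_smul hA₁ _)
  have hsos : q • (X₀ * X₀) + p • (X₁ * X₁) = (2 * c ^ 2 * (p + q)) • (1 : Matrix ι ι ℂ)
      - (2 * c) • ((q * t) • (A₀ * B₀) + (p * q) • (A₀ * B₁ + A₁ * B₀)
        - (p * t) • (A₁ * B₁)) := by
    simp only [hX₀, hX₁, sub_mul, mul_sub, add_mul, mul_add, smul_mul_assoc, mul_smul_comm,
      sA₀, sA₁, sB₀, sB₁, ← c00.eq, ← c01.eq, ← c10.eq, ← c11.eq]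
    match_scalars <;> first | ring1 | linear_combination (-(p + q)) * hrel
  have hone : expect ψ (1 : Matrix ι ι ℂ) = 1 := by rw [expect, Matrix.one_mulVec, hψ]
  have hsum := congrArg (fun X => (expect ψ X).re) hsos
  simp only [expect_add, expect_sub, expect_smul, hone, Complex.add_re, Complex.sub_re,
    Complex.re_ofReal_mul, Complex.one_re] at hsum
  have n₀ := (Complex.nonneg_iff.1 (expect_sq_nonneg ψ herm₀)).1
  have n₁ := (Complex.nonneg_iff.1 (expect_sq_nonneg ψ herm₁)).1
  have hzero : q * (expect ψ (X₀ * X₀)).re + p * (expect ψ (X₁ * X₁)).re = 0 := by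
    rw [hsum]; linear_combination (-2 * c) * hmax
  have z₀ := mulVec_eq_zero_of_expect_sq ψ herm₀ (by nlinarith [mul_nonneg hp.le n₁])
  have z₁ := mulVec_eq_zero_of_expect_sq ψ herm₁ (by nlinarith [mul_nonneg hq.le n₀])
  -- Solving `X₀ ψ = X₁ ψ = 0` for Alice's operators; the determinant of the system is `-c²`.
  have hc0 : c ≠ 0 := hc.ne'
  have r₀ : A₀ *ᵥ ψ = ((t / c) • B₀ + (p / c) • B₁) *ᵥ ψ := by
    have e : A₀ = ((t / c) • B₀ + (p / c) • B₁) - ((t / c ^ 2) • X₀ + (p / c ^ 2) • X₁) := by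
      simp only [hX₀, hX₁]
      match_scalars <;> field_simp <;> first | ring1 | linear_combination hrel
    conv_lhs => rw [e]
    simp only [Matrix.sub_mulVec _ (_ • X₀ + _), Matrix.add_mulVec (_ • X₀),
      Matrix.smul_mulVec _ X₀, Matrix.smul_mulVec _ X₁, z₀, z₁, smul_zero, add_zero, sub_zero]
  have r₁ : A₁ *ᵥ ψ = ((q / c) • B₀ - (t / c) • B₁) *ᵥ ψ := by
    have e : A₁ = ((q / c) • B₀ - (t / c) • B₁) - ((q / c ^ 2) • X₀ - (t / c ^ 2) • X₁) := by
      simp only [hX₀, hX₁]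
      match_scalars <;> field_simp <;> first | ring1 | linear_combination hrel
    conv_lhs => rw [e]
    simp only [Matrix.sub_mulVec _ (_ • X₀ - _), Matrix.sub_mulVec (_ • X₀),
      Matrix.smul_mulVec _ X₀, Matrix.smul_mulVec _ X₁, z₀, z₁, smul_zero, sub_zero]
  -- `B₀² = 1` turns `c B₀ ψ = (t A₀ + p A₁) ψ` into a relation for the anticommutator.
  have hanti : (A₀ * A₁ + A₁ * A₀) *ᵥ ψ = ((q - p) / t) • ψ := by
    have e : (t * p) • (A₀ * A₁ + A₁ * A₀)
        = (t * q * p - t * p ^ 2) • ((1 / t) • (1 : Matrix ι ι ℂ)) - (c • B₀ + t • A₀ + p • A₁) * X₀ := by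
      simp only [hX₀, mul_sub, add_mul, smul_mul_assoc, mul_smul_comm,
        sA₀, sA₁, sB₀, ← c00.eq, ← c10.eq]
      match_scalars <;> field_simp <;> first | ring1 | linear_combination hrel
    have e' := congrArg (fun X => X *ᵥ ψ) e
    simp only [Matrix.smul_mulVec, Matrix.sub_mulVec _ (_ * X₀), ← Matrix.mulVec_mulVec _ _ X₀,
      z₀, Matrix.mulVec_zero, sub_zero, Matrix.one_mulVec] at e'
    have htp : t * p ≠ 0 := (mul_pos ht hp).ne'
    apply smul_right_injective _ htp
    simp only [e']
    match_scalars
    field_simp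
  have hκ : ((q - p) / t) ^ 2 ≠ 4 := by
    rw [div_pow, Ne, div_eq_iff (by positivity)]
    exact hne
  have hermC : ((t / c) • B₀ + (p / c) • B₁).IsHermitian :=
    (isHermitian_smul hB₀ _).add (isHermitian_smul hB₁ _)
  have hermC' : ((q / c) • B₀ - (t / c) • B₁).IsHermitian :=
    (isHermitian_smul hB₀ _).sub (isHermitian_smul hB₁ _)
  have k {Y : Matrix ι ι ℂ} (h₀ : Commute Y B₀) (h₁ : Commute Y B₁) :
      Commute Y ((t / c) • B₀ + (p / c) • B₁) :=
    (h₀.smul_right _).add_right (h₁.smul_right _)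
  have k' {Y : Matrix ι ι ℂ} (h₀ : Commute Y B₀) (h₁ : Commute Y B₁) :
      Commute Y ((q / c) • B₀ - (t / c) • B₁) :=
    (h₀.smul_right _).sub_right (h₁.smul_right _)
  exact ⟨expect_mul_eq_zero_of_anticomm hκ hA₀ hA₁ hermC hermC' sA₀ sA₁ hanti r₀ r₁
      (k c00 c01) (k' c00 c01) (k c10 c11) (k' c10 c11) cA₀ cA₁ (k cB₀ cB₁) (k' cB₀ cB₁),
    expect_mul_eq_zero_of_anticomm hκ hA₁ hA₀ hermC' hermC sA₁ sA₀ (by rw [add_comm, hanti]) r₁ r₀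
      (k' c10 c11) (k c10 c11) (k' c00 c01) (k c00 c01) cA₁ cA₀ (k' cB₀ cB₁) (k cB₀ cB₁)⟩

end VectorState

/-! ### The entropy of a copy of Eve's state with a uniform bit -/

section Entropy

variable {n : Type*} [Fintype n] [DecidableEq n]

/-- The embedding `ρ ↦ ρ ⊗ 1₂`, in block diagonal form, as a star homomorphism; it transports the
functional calculus. -/
def twoCopies : Matrix n n ℂ →⋆ₐ[ℂ] Matrix (n × Fin 2) (n × Fin 2) ℂ where
  toFun X := Matrix.blockDiagonal fun _ => X
  map_one' := Matrix.blockDiagonal_one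
  map_mul' X Y := Matrix.blockDiagonal_mul _ _
  map_zero' := Matrix.blockDiagonal_zero
  map_add' X Y := Matrix.blockDiagonal_add _ _
  commutes' r := by
    simp only [Algebra.algebraMap_eq_smul_one]
    exact (Matrix.blockDiagonal_smul r (fun _ : Fin 2 => (1 : Matrix n n ℂ))).trans
      (congrArg (r • ·) Matrix.blockDiagonal_one)
  map_star' X := (Matrix.blockDiagonal_conjTranspose _).symm

lemma vonNeumannEntropy_half_copies {ρ : Matrix n n ℂ} (hρ : ρ.IsHermitian)
    (htr : ρ.trace = 1) :
    vonNeumannEntropy (Matrix.blockDiagonal fun _ : Fin 2 => (1 / 2 : ℝ) • ρ)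
      = vonNeumannEntropy ρ + 1 := by
  set f : ℝ → ℝ := fun t => t * Real.logb 2 t with hf
  have hfc : Continuous f := by
    have : f = fun t => t * Real.log t / Real.log 2 := by
      funext t; simp only [hf, Real.logb, mul_div_assoc]
    rw [this]
    exact Real.continuous_mul_log.div_const _
  have hhalf : (fun t : ℝ => f (1 / 2 * t)) = fun t => (1 / 2) * f t - (1 / 2) * t := by
    funext t
    rcases eq_or_ne t 0 with rfl | ht
    · simp [hf]
    · simp only [hf]
      rw [Real.logb_mul (by norm_num) ht, one_div, Real.logb_inv, Real.logb_self_eq_one one_lt_two]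
      ring
  have hρ' : IsSelfAdjoint ρ := hρ
  have hsa : IsSelfAdjoint ((1 / 2 : ℝ) • ρ) := isHermitian_smul hρ _
  have hcont : Continuous (twoCopies (n := n)) :=
    Continuous.matrix_blockDiagonal (continuous_pi fun _ => continuous_id)
  have hmap : cfc f (Matrix.blockDiagonal fun _ : Fin 2 => (1 / 2 : ℝ) • ρ)
      = Matrix.blockDiagonal fun _ : Fin 2 => cfc f ((1 / 2 : ℝ) • ρ) :=
    ((twoCopies (n := n)).map_cfc f ((1 / 2 : ℝ) • ρ) hfc.continuousOn hcont hsa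
      (hsa.map twoCopies)).symm
  have hscale : cfc f ((1 / 2 : ℝ) • ρ) = (1 / 2 : ℝ) • cfc f ρ - (1 / 2 : ℝ) • ρ := by
    rw [← cfc_comp_const_mul (1 / 2 : ℝ) f ρ hfc.continuousOn hρ', hhalf,
      cfc_sub (fun t => 1 / 2 * f t) (fun t => 1 / 2 * t) ρ
        (continuous_const.mul hfc).continuousOn (continuous_const.mul continuous_id).continuousOn,
      cfc_const_mul (1 / 2 : ℝ) f ρ hfc.continuousOn, cfc_const_mul_id (1 / 2 : ℝ) ρ hρ']
  unfold vonNeumannEntropy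
  rw [hmap, Matrix.trace_blockDiagonal, hscale]
  simp [Matrix.trace_sub, Matrix.trace_smul, htr]
  ring

end Entropy

/-! ### The chosen parameters -/

lemma bellValue_params (a t : ℝ) (P : Behaviour) :
    bellValue (-(a + t)) (Real.pi / 2 + a) (Real.pi / 2 - t) P
      = Real.sin t * (Real.sin (a + 2 * t) * Real.sin t * correlator P 0 0
        + Real.sin a * Real.sin (a + 2 * t) * (correlator P 0 1 + correlator P 1 0)
        - Real.sin a * Real.sin t * correlator P 1 1) := by
  rw [bellValue, show -(a + t) + (Real.pi / 2 + a) = Real.pi / 2 - t by ring,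
    show -(a + t) + (Real.pi / 2 - t) = Real.pi / 2 - (a + 2 * t) by ring,
    add_comm (Real.pi / 2) a, Real.cos_add_pi_div_two, Real.cos_pi_div_two_sub,
    Real.cos_pi_div_two_sub]
  ring

lemma etaQ_params (a t : ℝ) :
    etaQ (-(a + t)) (Real.pi / 2 + a) (Real.pi / 2 - t)
      = Real.sin (a + t) ^ 2 * (2 * Real.sin t * Real.cos t) := by
  rw [etaQ, show Real.pi / 2 - t - (Real.pi / 2 + a) = -(a + t) by ring,
    show -(a + t) + (Real.pi / 2 - t) + (Real.pi / 2 + a) = Real.pi - 2 * t by ring,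
    Real.sin_neg, Real.sin_pi_sub, Real.sin_two_mul]
  ring

lemma signCondition_params {a t : ℝ} (ha : 0 < a) (ht : 0 < t) (hat : a + 2 * t < Real.pi) :
    SignCondition (-(a + t)) (Real.pi / 2 + a) (Real.pi / 2 - t) := by
  have hpa : 0 < Real.sin a := Real.sin_pos_of_pos_of_lt_pi ha (by linarith)
  have hpt : 0 < Real.sin t := Real.sin_pos_of_pos_of_lt_pi ht (by linarith)
  have hpq : 0 < Real.sin (a + 2 * t) := Real.sin_pos_of_pos_of_lt_pi (by linarith) hat
  rw [SignCondition, show -(a + t) + (Real.pi / 2 + a) = Real.pi / 2 - t by ring,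
    show -(a + t) + (Real.pi / 2 - t) = Real.pi / 2 - (a + 2 * t) by ring,
    add_comm (Real.pi / 2) a, Real.cos_add_pi_div_two, Real.cos_pi_div_two_sub,
    Real.cos_pi_div_two_sub]
  have := mul_pos (mul_pos (mul_pos hpt hpa) hpq) hpt
  linarith

/-! ### Optimal strategies yield a uniform bit -/

namespace Strategy

variable (S : Strategy)

/-- Alice's observable `A_x = M_{0|x} - M_{1|x}` on the global space. -/
def aliceOp (x : Fin 2) :
    Matrix ((Fin S.dA × Fin S.dB) × Fin S.dE) ((Fin S.dA × Fin S.dB) × Fin S.dE) ℂ :=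
  ((S.M x 0 - S.M x 1) ⊗ₖ (1 : Matrix (Fin S.dB) (Fin S.dB) ℂ)) ⊗ₖ
    (1 : Matrix (Fin S.dE) (Fin S.dE) ℂ)

/-- Bob's observable `B_y = N_{0|y} - N_{1|y}` on the global space. -/
def bobOp (y : Fin 2) :
    Matrix ((Fin S.dA × Fin S.dB) × Fin S.dE) ((Fin S.dA × Fin S.dB) × Fin S.dE) ℂ :=
  ((1 : Matrix (Fin S.dA) (Fin S.dA) ℂ) ⊗ₖ (S.N y 0 - S.N y 1)) ⊗ₖ
    (1 : Matrix (Fin S.dE) (Fin S.dE) ℂ)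

/-- An operator of Eve on the global space. -/
def eveOp (Z : Matrix (Fin S.dE) (Fin S.dE) ℂ) :
    Matrix ((Fin S.dA × Fin S.dB) × Fin S.dE) ((Fin S.dA × Fin S.dB) × Fin S.dE) ℂ :=
  (1 : Matrix (Fin S.dA × Fin S.dB) (Fin S.dA × Fin S.dB) ℂ) ⊗ₖ Z

lemma sq_diff_of_isStarProjection {n : Type*} [Fintype n] [DecidableEq n]
    {P : Fin 2 → Matrix n n ℂ} (hP : ∀ a, IsStarProjection (P a)) (hsum : ∑ a, P a = 1) :
    (P 0 - P 1) * (P 0 - P 1) = 1 := by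
  rw [Fin.sum_univ_two] at hsum
  have h1 : P 1 = 1 - P 0 := by rw [← hsum, add_sub_cancel_left]
  have h0 : P 0 * P 0 = P 0 := (hP 0).isIdempotentElem
  rw [h1]
  simp only [sub_mul, mul_sub, one_mul, mul_one, h0]
  abel

lemma aliceOp_isHermitian (x : Fin 2) : (S.aliceOp x).IsHermitian := by
  have h (a) : (S.M x a)ᴴ = S.M x a := (S.M_proj x a).isSelfAdjoint
  simp only [Matrix.IsHermitian, aliceOp, Matrix.conjTranspose_kronecker,
    Matrix.conjTranspose_sub, Matrix.conjTranspose_one, h]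

lemma bobOp_isHermitian (y : Fin 2) : (S.bobOp y).IsHermitian := by
  have h (b) : (S.N y b)ᴴ = S.N y b := (S.N_proj y b).isSelfAdjoint
  simp only [Matrix.IsHermitian, bobOp, Matrix.conjTranspose_kronecker,
    Matrix.conjTranspose_sub, Matrix.conjTranspose_one, h]

lemma aliceOp_sq (x : Fin 2) : S.aliceOp x * S.aliceOp x = 1 := by
  simp only [aliceOp, ← Matrix.mul_kronecker_mul, mul_one, Matrix.one_kronecker_one,
    sq_diff_of_isStarProjection (S.M_proj x) (S.M_sum x)]

lemma bobOp_sq (y : Fin 2) : S.bobOp y * S.bobOp y = 1 := by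
  simp only [bobOp, ← Matrix.mul_kronecker_mul, mul_one, Matrix.one_kronecker_one,
    sq_diff_of_isStarProjection (S.N_proj y) (S.N_sum y)]

lemma commute_aliceOp_bobOp (x y : Fin 2) : Commute (S.aliceOp x) (S.bobOp y) := by
  simp only [Commute, SemiconjBy, aliceOp, bobOp, ← Matrix.mul_kronecker_mul, mul_one, one_mul]

lemma commute_eveOp_aliceOp (Z : Matrix (Fin S.dE) (Fin S.dE) ℂ) (x : Fin 2) :
    Commute (S.eveOp Z) (S.aliceOp x) := by
  simp only [Commute, SemiconjBy, aliceOp, eveOp, ← Matrix.mul_kronecker_mul, mul_one, one_mul]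

lemma commute_eveOp_bobOp (Z : Matrix (Fin S.dE) (Fin S.dE) ℂ) (y : Fin 2) :
    Commute (S.eveOp Z) (S.bobOp y) := by
  simp only [Commute, SemiconjBy, bobOp, eveOp, ← Matrix.mul_kronecker_mul, mul_one, one_mul]

lemma star_dotProduct_ψ : star S.ψ ⬝ᵥ S.ψ = 1 := by
  have h : ∀ i, star (S.ψ i) * S.ψ i = ((‖S.ψ i‖ ^ 2 : ℝ) : ℂ) := fun i => by
    push_cast
    exact Complex.conj_mul' _
  simp only [dotProduct, Pi.star_apply, h]
  rw [← Complex.ofReal_sum, S.ψ_unit, Complex.ofReal_one]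

lemma correlator_behaviour (x y : Fin 2) :
    correlator S.behaviour x y = (expect S.ψ (S.aliceOp x * S.bobOp y)).re := by
  have e : S.aliceOp x * S.bobOp y
      = ((S.M x 0 ⊗ₖ S.N y 0) ⊗ₖ (1 : Matrix (Fin S.dE) (Fin S.dE) ℂ)
        - (S.M x 0 ⊗ₖ S.N y 1) ⊗ₖ (1 : Matrix (Fin S.dE) (Fin S.dE) ℂ))
        - ((S.M x 1 ⊗ₖ S.N y 0) ⊗ₖ (1 : Matrix (Fin S.dE) (Fin S.dE) ℂ)
        - (S.M x 1 ⊗ₖ S.N y 1) ⊗ₖ (1 : Matrix (Fin S.dE) (Fin S.dE) ℂ)) := by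
    simp only [aliceOp, bobOp, ← Matrix.mul_kronecker_mul, mul_one, one_mul]
    ext ⟨⟨i, j⟩, k⟩ ⟨⟨i', j'⟩, k'⟩
    simp only [Matrix.kroneckerMap_apply, Matrix.sub_apply]
    ring
  simp only [correlator, behaviour, globalState, expect_trace, Fin.sum_univ_two, e, expect_sub,
    Complex.sub_re]
  simp
  ring

/-- Eve's reduced operators are read off from expectations of her matrix units. -/
lemma partialTraceLeft_mul_globalState
    (X : Matrix ((Fin S.dA × Fin S.dB) × Fin S.dE) ((Fin S.dA × Fin S.dB) × Fin S.dE) ℂ)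
    (k l : Fin S.dE) :
    partialTraceLeft (X * S.globalState) k l
      = expect S.ψ (S.eveOp (Matrix.single l k 1) * X) := by
  rw [globalState, Matrix.mul_vecMulVec, expect, ← Matrix.mulVec_mulVec]
  set v := X *ᵥ S.ψ
  have hv : S.eveOp (Matrix.single l k 1) *ᵥ v = fun i => if i.2 = l then v (i.1, k) else 0 := by
    funext ⟨i, e⟩
    simp [Matrix.mulVec, dotProduct, eveOp, Fintype.sum_prod_type_right, Matrix.one_apply,
      Matrix.single_apply, eq_comm, ite_and]
  rw [hv]
  simp [partialTraceLeft, Matrix.vecMulVec_apply, dotProduct, Fintype.sum_prod_type_right,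
    mul_comm]

lemma eveCondState_eq_half {x : Fin 2}
    (h : ∀ Z, expect S.ψ (S.aliceOp x * S.eveOp Z) = 0) (a : Fin 2) :
    S.eveCondState x a = (1 / 2 : ℝ) • S.eveState := by
  set X : Fin 2 → Matrix ((Fin S.dA × Fin S.dB) × Fin S.dE) ((Fin S.dA × Fin S.dB) × Fin S.dE) ℂ :=
    fun a => (S.M x a ⊗ₖ (1 : Matrix (Fin S.dB) (Fin S.dB) ℂ)) ⊗ₖ
      (1 : Matrix (Fin S.dE) (Fin S.dE) ℂ) with hX
  have hadd : X 0 + X 1 = 1 := by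
    have hM := S.M_sum x
    rw [Fin.sum_univ_two] at hM
    simp only [hX, ← Matrix.add_kronecker, hM, Matrix.one_kronecker_one]
  have hsub : X 0 - X 1 = S.aliceOp x := by
    simp only [hX, aliceOp]
    ext ⟨⟨i, j⟩, k⟩ ⟨⟨i', j'⟩, k'⟩
    simp only [Matrix.kroneckerMap_apply, Matrix.sub_apply]
    ring
  ext k l
  have e₁ : expect S.ψ (S.eveOp (Matrix.single l k 1) * X 0)
      + expect S.ψ (S.eveOp (Matrix.single l k 1) * X 1) = S.eveState k l := by
    rw [← expect_add, ← mul_add, hadd, ← partialTraceLeft_mul_globalState, one_mul, eveState]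
  have e₂ : expect S.ψ (S.eveOp (Matrix.single l k 1) * X 0)
      - expect S.ψ (S.eveOp (Matrix.single l k 1) * X 1) = 0 := by
    rw [← expect_sub, ← mul_sub, hsub, (S.commute_eveOp_aliceOp _ x).eq, h]
  have e₃ : S.eveCondState x a k l = expect S.ψ (S.eveOp (Matrix.single l k 1) * X a) := by
    rw [← partialTraceLeft_mul_globalState, eveCondState]
  rw [e₃, Matrix.smul_apply, Complex.real_smul, ← e₁]
  push_cast
  obtain rfl | rfl : a = 0 ∨ a = 1 := by omega
  · linear_combination (1 / 2 : ℂ) * e₂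
  · linear_combination (-1 / 2 : ℂ) * e₂

lemma condEntropyEve_eq_one {x : Fin 2}
    (h : ∀ Z, expect S.ψ (S.aliceOp x * S.eveOp Z) = 0) : S.condEntropyEve x = 1 := by
  have hherm : S.eveState.IsHermitian := by
    ext k l
    simp [eveState, partialTraceLeft, globalState, Matrix.vecMulVec_apply, mul_comm]
  have htr : S.eveState.trace = 1 := by
    rw [← S.star_dotProduct_ψ]
    simp only [eveState, partialTraceLeft, globalState, Matrix.trace, Matrix.diag_apply,
      Matrix.of_apply, Matrix.vecMulVec_apply, dotProduct]
    rw [Fintype.sum_prod_type_right]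
    simp only [mul_comm]
  simp only [condEntropyEve, cqState, S.eveCondState_eq_half h,
    vonNeumannEntropy_half_copies hherm htr, add_sub_cancel_left]

/-- Up to the factor `sin t`, the Bell expression is the one of `expect_alice_mul_eq_zero` with
`p = sin a`, `q = sin (a + 2t)` and `c = sin (a + t)`. -/
lemma condEntropyEve_eq_one_of_bellValue {a t : ℝ} (ha : 0 < a) (ht : 0 < t)
    (hat : a + 2 * t < Real.pi)
    (h : bellValue (-(a + t)) (Real.pi / 2 + a) (Real.pi / 2 - t) S.behaviour
      = etaQ (-(a + t)) (Real.pi / 2 + a) (Real.pi / 2 - t)) (x : Fin 2) :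
    S.condEntropyEve x = 1 := by
  have hpa : 0 < Real.sin a := Real.sin_pos_of_pos_of_lt_pi ha (by linarith)
  have hpt : 0 < Real.sin t := Real.sin_pos_of_pos_of_lt_pi ht (by linarith)
  have hpq : 0 < Real.sin (a + 2 * t) := Real.sin_pos_of_pos_of_lt_pi (by linarith) hat
  have hpc : 0 < Real.sin (a + t) := Real.sin_pos_of_pos_of_lt_pi (by linarith) (by linarith)
  have ea : Real.sin a = Real.sin (a + t) * Real.cos t - Real.cos (a + t) * Real.sin t := by
    rw [← Real.sin_sub]; ring_nf
  have eq : Real.sin (a + 2 * t)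
      = Real.sin (a + t) * Real.cos t + Real.cos (a + t) * Real.sin t := by
    rw [← Real.sin_add]; ring_nf
  have p₁ := Real.sin_sq_add_cos_sq t
  have p₂ := Real.sin_sq_add_cos_sq (a + t)
  have hmax : Real.sin (a + 2 * t) * Real.sin t * correlator S.behaviour 0 0
      + Real.sin a * Real.sin (a + 2 * t)
        * (correlator S.behaviour 0 1 + correlator S.behaviour 1 0)
      - Real.sin a * Real.sin t * correlator S.behaviour 1 1
      = Real.sin (a + t) * (Real.sin a + Real.sin (a + 2 * t)) := by
    apply mul_left_cancel₀ hpt.ne'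
    rw [bellValue_params, etaQ_params] at h
    rw [h, ea, eq]
    ring
  simp only [correlator_behaviour] at hmax
  have key (Z) := expect_alice_mul_eq_zero (Z := S.eveOp Z) hpa hpq hpt hpc
    (by rw [ea, eq]; linear_combination (Real.sin t ^ 2) * p₂ - (Real.sin (a + t) ^ 2) * p₁)
    (by
      rw [ea, eq]
      intro h'
      -- `4 t² - (q - p)² = 4 sin² t sin² (a + t)`.
      have : (2 * Real.sin t * Real.sin (a + t)) ^ 2 = 0 := by
        linear_combination -h' + 4 * Real.sin t ^ 2 * p₂
      have := pow_eq_zero_iff (two_ne_zero) |>.1 this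
      exact (mul_pos (mul_pos two_pos hpt) hpc).ne' this)
    S.star_dotProduct_ψ (S.aliceOp_isHermitian 0) (S.aliceOp_isHermitian 1)
    (S.bobOp_isHermitian 0) (S.bobOp_isHermitian 1) (S.aliceOp_sq 0) (S.aliceOp_sq 1)
    (S.bobOp_sq 0) (S.bobOp_sq 1) (S.commute_aliceOp_bobOp 0 0) (S.commute_aliceOp_bobOp 0 1)
    (S.commute_aliceOp_bobOp 1 0) (S.commute_aliceOp_bobOp 1 1) (S.commute_eveOp_aliceOp Z 0)
    (S.commute_eveOp_aliceOp Z 1) (S.commute_eveOp_bobOp Z 0) (S.commute_eveOp_bobOp Z 1) hmax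
  refine S.condEntropyEve_eq_one fun Z => ?_
  fin_cases x
  · exact (key Z).1
  · exact (key Z).2

end Strategy

/-! ### Qubit strategies -/

/-- The reflection `cos α σ_z + sin α σ_x`. -/
noncomputable def reflection (α : ℝ) : Matrix (Fin 2) (Fin 2) ℂ :=
  !![(Real.cos α : ℂ), Real.sin α; Real.sin α, -Real.cos α]

/-- The projector onto the eigenspace of `reflection α` for the eigenvalue `(-1) ^ a`. -/
noncomputable def qubitProj (α : ℝ) (a : Fin 2) : Matrix (Fin 2) (Fin 2) ℂ :=
  (1 / 2 : ℂ) • (1 + (-1 : ℂ) ^ (a : ℕ) • reflection α)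

lemma isStarProjection_qubitProj (α : ℝ) (a : Fin 2) : IsStarProjection (qubitProj α a) := by
  have p : (Real.sin α : ℂ) ^ 2 + (Real.cos α : ℂ) ^ 2 = 1 := by
    exact_mod_cast Real.sin_sq_add_cos_sq α
  constructor
  · rw [IsIdempotentElem]
    ext i j
    fin_cases a <;> fin_cases i <;> fin_cases j <;>
      simp [qubitProj, reflection, Matrix.mul_apply, -Complex.ofReal_cos, -Complex.ofReal_sin] <;>
      first | ring1 | linear_combination (1 / 4 : ℂ) * p
  · rw [IsSelfAdjoint, Matrix.star_eq_conjTranspose]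
    ext i j
    fin_cases a <;> fin_cases i <;> fin_cases j <;>
      simp [qubitProj, reflection, Matrix.conjTranspose_apply, -Complex.ofReal_cos,
        -Complex.ofReal_sin] <;>
      ring1

lemma sum_qubitProj (α : ℝ) : ∑ a, qubitProj α a = 1 := by
  simp only [qubitProj, Fin.sum_univ_two]
  simp
  module

/-- The maximally entangled state `(|00⟩ + |11⟩) / √2` of two qubits, with a trivial third system
for Eve. -/
noncomputable def bellVector (i : (Fin 2 × Fin 2) × Fin 1) : ℂ :=
  if i.1.1 = i.1.2 then (((√2)⁻¹ : ℝ) : ℂ) else 0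

lemma expect_bellVector (M N : Matrix (Fin 2) (Fin 2) ℂ) :
    expect bellVector ((M ⊗ₖ N) ⊗ₖ (1 : Matrix (Fin 1) (Fin 1) ℂ))
      = 1 / 2 * ∑ i, ∑ j, M i j * N i j := by
  have h2 : (((√2)⁻¹ : ℝ) : ℂ) * (((√2)⁻¹ : ℝ) : ℂ) = 1 / 2 := by
    rw [← Complex.ofReal_mul, ← mul_inv, Real.mul_self_sqrt (by norm_num)]
    norm_num
  simp [expect, dotProduct, Matrix.mulVec, bellVector, Fintype.sum_prod_type, Fin.sum_univ_two,
    -Complex.ofReal_inv]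
  linear_combination (M 0 0 * N 0 0 + M 0 1 * N 0 1 + M 1 0 * N 1 0 + M 1 1 * N 1 1) * h2

/-- Real projective measurements at angles `α x` and `β y` on a maximally entangled pair of
qubits. -/
noncomputable def qubitStrategy (α β : Fin 2 → ℝ) : Strategy where
  dA := 2
  dB := 2
  dE := 1
  ψ := bellVector
  ψ_unit := by
    simp [bellVector, Fintype.sum_prod_type, Fin.sum_univ_two]
    norm_num
  M x a := qubitProj (α x) a
  M_proj x a := isStarProjection_qubitProj _ _
  M_sum x := sum_qubitProj _
  N y b := qubitProj (β y) b
  N_proj y b := isStarProjection_qubitProj _ _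
  N_sum y := sum_qubitProj _

/-- The behaviour with uniform marginals and correlators `E x y`. -/
noncomputable def unbiased (E : Fin 2 → Fin 2 → ℝ) : Behaviour :=
  fun x y a b => (1 + (-1) ^ ((a : ℕ) + (b : ℕ)) * E x y) / 4

lemma behaviour_qubitStrategy (α β : Fin 2 → ℝ) :
    (qubitStrategy α β).behaviour = unbiased fun x y => Real.cos (α x - β y) := by
  funext x y a b
  simp only [Strategy.behaviour, Strategy.globalState, expect_trace, unbiased]
  have : expect bellVector
      ((qubitProj (α x) a ⊗ₖ qubitProj (β y) b) ⊗ₖ (1 : Matrix (Fin 1) (Fin 1) ℂ))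
      = (((1 + (-1) ^ ((a : ℕ) + (b : ℕ)) * Real.cos (α x - β y)) / 4 : ℝ) : ℂ) := by
    rw [expect_bellVector, Real.cos_sub]
    fin_cases a <;> fin_cases b <;>
      simp [qubitProj, reflection, Fin.sum_univ_two] <;> ring1
  exact (congrArg Complex.re this).trans (Complex.ofReal_re _)

lemma correlator_unbiased (E : Fin 2 → Fin 2 → ℝ) (x y : Fin 2) :
    correlator (unbiased E) x y = E x y := by
  simp [correlator, unbiased, Fin.sum_univ_two]
  ring

/-! ### Binary entropies -/

/-- The binary entropy, in bits, of a bit with bias `E`. -/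
noncomputable def biasEntropy (E : ℝ) : ℝ := Real.binEntropy ((1 + E) / 2) / Real.log 2

lemma condShannon_unbiased (E : Fin 2 → Fin 2 → ℝ) (x y : Fin 2) (h₁ : -1 < E x y)
    (h₂ : E x y < 1) : condShannon (unbiased E x y) = biasEntropy (E x y) := by
  have l2 : Real.log 2 ≠ 0 := (Real.log_pos one_lt_two).ne'
  have l4 : Real.log 4 = 2 * Real.log 2 := by
    rw [show (4 : ℝ) = 2 ^ 2 by norm_num, Real.log_pow]; norm_num
  have n₁ : 1 + E x y ≠ 0 := by linarith
  have n₂ : 1 - E x y ≠ 0 := by linarith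
  have s₁ : (1 + E x y) / 4 + (1 - E x y) / 4 = 2⁻¹ := by ring
  have s₂ : (1 - E x y) / 4 + (1 + E x y) / 4 = 2⁻¹ := by ring
  have e : 1 - (1 + E x y) / 2 = (1 - E x y) / 2 := by ring
  simp [condShannon, unbiased, biasEntropy, Real.binEntropy, Fin.sum_univ_two, Real.logb, e]
  simp only [← sub_eq_add_neg (1 : ℝ)]
  rw [s₁, s₂, Real.log_inv, Real.log_div n₁ (by norm_num),
    Real.log_div n₂ (by norm_num), Real.log_div (by norm_num) n₁, Real.log_div (by norm_num) n₂, l4]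
  field_simp
  ring

lemma biasEntropy_abs (E : ℝ) : biasEntropy |E| = biasEntropy E := by
  rcases abs_choice E with h | h <;> rw [h]
  rw [biasEntropy, biasEntropy, ← Real.binEntropy_one_sub]
  ring_nf

lemma continuous_biasEntropy : Continuous biasEntropy := by
  unfold biasEntropy
  fun_prop

lemma strictAntiOn_biasEntropy : StrictAntiOn biasEntropy (Set.Icc 0 1) := by
  intro u hu v hv huv
  refine div_lt_div_of_pos_right (Real.binEntropy_strictAntiOn ?_ ?_ ?_) (Real.log_pos one_lt_two)
  · constructor <;> linarith [hu.1, hu.2]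
  · constructor <;> linarith [hv.1, hv.2]
  · linarith

lemma biasEntropy_one : biasEntropy 1 = 0 := by
  norm_num [biasEntropy]

lemma biasEntropy_half : biasEntropy (1 / 2) = 2 - 3 / 4 * Real.logb 2 3 := by
  have l2 : Real.log 2 ≠ 0 := (Real.log_pos one_lt_two).ne'
  have l4 : Real.log 4 = 2 * Real.log 2 := by
    rw [show (4 : ℝ) = 2 ^ 2 by norm_num, Real.log_pow]; norm_num
  rw [biasEntropy, Real.binEntropy, Real.logb, show ((1 + 1 / 2) / 2 : ℝ)⁻¹ = 4 / 3 by norm_num,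
    show (1 - (1 + 1 / 2) / 2 : ℝ)⁻¹ = 4 by norm_num, Real.log_div (by norm_num) (by norm_num), l4]
  field_simp
  ring

/-! ### Key rates at the quantum bound -/

/-- The qubit strategy that attains the quantum bound: Alice measures at angles `0` and `a + t`, Bob
at angles `a` and `-t`. -/
noncomputable def optimalStrategy (a t : ℝ) : Strategy := qubitStrategy ![0, a + t] ![a, -t]

/-- The correlators `⟨A_x B_y⟩` of `optimalStrategy a t`. -/
noncomputable def optimalCorrelator (a t : ℝ) (x y : Fin 2) : ℝ :=
  !![Real.cos a, Real.cos t; Real.cos t, Real.cos (a + 2 * t)] x y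

lemma behaviour_optimalStrategy (a t : ℝ) :
    (optimalStrategy a t).behaviour = unbiased (optimalCorrelator a t) := by
  rw [optimalStrategy, behaviour_qubitStrategy]
  congr 1
  funext x y
  fin_cases x <;> fin_cases y <;> simp [optimalCorrelator]
  ring_nf

lemma chsh_optimalStrategy (a t : ℝ) : chsh (optimalStrategy a t).behaviour
    = Real.cos a + 2 * Real.cos t - Real.cos (a + 2 * t) := by
  rw [behaviour_optimalStrategy]
  simp [chsh, correlator_unbiased, optimalCorrelator]
  ring

lemma bellValue_optimalStrategy (a t : ℝ) :
    bellValue (-(a + t)) (Real.pi / 2 + a) (Real.pi / 2 - t) (optimalStrategy a t).behaviour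
      = etaQ (-(a + t)) (Real.pi / 2 + a) (Real.pi / 2 - t) := by
  have p₁ := Real.sin_sq_add_cos_sq t
  have sa : Real.sin a = Real.sin (a + t) * Real.cos t - Real.cos (a + t) * Real.sin t := by
    rw [← Real.sin_sub]; ring_nf
  have ca : Real.cos a = Real.cos (a + t) * Real.cos t + Real.sin (a + t) * Real.sin t := by
    rw [← Real.cos_sub]; ring_nf
  have sq : Real.sin (a + 2 * t)
      = Real.sin (a + t) * Real.cos t + Real.cos (a + t) * Real.sin t := by
    rw [← Real.sin_add]; ring_nf
  have cq : Real.cos (a + 2 * t)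
      = Real.cos (a + t) * Real.cos t - Real.sin (a + t) * Real.sin t := by
    rw [← Real.cos_add]; ring_nf
  rw [bellValue_params, etaQ_params, behaviour_optimalStrategy]
  simp only [correlator_unbiased, optimalCorrelator, Matrix.of_apply, Matrix.cons_val_zero,
    Matrix.cons_val_one, Matrix.cons_val', Matrix.cons_val_fin_one]
  rw [sa, ca, sq, cq]
  linear_combination (2 * Real.sin t * Real.cos t * Real.sin (a + t) ^ 2) * p₁

lemma certifiedEntropy_params {a t : ℝ} (ha : 0 < a) (ht : 0 < t) (hat : a + 2 * t < Real.pi)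
    (x : Fin 2) :
    certifiedEntropy (-(a + t)) (Real.pi / 2 + a) (Real.pi / 2 - t)
      (etaQ (-(a + t)) (Real.pi / 2 + a) (Real.pi / 2 - t)) x = 1 := by
  have : {h : ℝ | ∃ S : Strategy,
      bellValue (-(a + t)) (Real.pi / 2 + a) (Real.pi / 2 - t) S.behaviour
        = etaQ (-(a + t)) (Real.pi / 2 + a) (Real.pi / 2 - t) ∧ S.condEntropyEve x = h} = {1} := by
    ext h
    constructor
    · rintro ⟨S, hS, rfl⟩
      exact S.condEntropyEve_eq_one_of_bellValue ha ht hat hS x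
    · rintro rfl
      exact ⟨optimalStrategy a t, bellValue_optimalStrategy a t,
        (optimalStrategy a t).condEntropyEve_eq_one_of_bellValue ha ht hat
          (bellValue_optimalStrategy a t) x⟩
  rw [certifiedEntropy, this, csInf_singleton]

lemma optimalCorrelator_mem {a t : ℝ} (ha : 0 < a) (ht : 0 < t) (hat : a + 2 * t < Real.pi)
    (x y : Fin 2) : -1 < optimalCorrelator a t x y ∧ optimalCorrelator a t x y < 1 := by
  have key {u : ℝ} (h₀ : 0 < u) (h₁ : u < Real.pi) : -1 < Real.cos u ∧ Real.cos u < 1 := by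
    constructor
    · simpa using Real.cos_lt_cos_of_nonneg_of_le_pi h₀.le le_rfl h₁
    · simpa using Real.cos_lt_cos_of_nonneg_of_le_pi le_rfl h₁.le h₀
  fin_cases x <;> fin_cases y
  · exact key ha (by linarith)
  · exact key ht (by linarith)
  · exact key ht (by linarith)
  · exact key (by linarith) hat

/-- Every strategy at the quantum bound leaves Eve ignorant of the outcome, so only the error
correction term remains. -/
lemma keyRateAt_params {a t : ℝ} (ha : 0 < a) (ht : 0 < t) (hat : a + 2 * t < Real.pi)
    (x y : Fin 2) :
    keyRateAt (-(a + t)) (Real.pi / 2 + a) (Real.pi / 2 - t)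
      (etaQ (-(a + t)) (Real.pi / 2 + a) (Real.pi / 2 - t)) (optimalStrategy a t).behaviour x y
      = 1 - biasEntropy (optimalCorrelator a t x y) := by
  have hm := optimalCorrelator_mem ha ht hat x y
  rw [keyRateAt, certifiedEntropy_params ha ht hat, behaviour_optimalStrategy,
    condShannon_unbiased _ _ _ hm.1 hm.2]

/-! ### Choice of the angles -/

/-- For every `a ≤ π / 3` the CHSH values in `(2, 5/2]` are reached with the two middle angles
equal. At `t = 0` the value is `2`; at `t = (π - a) / 3` it is `6c - 4c³` with `c = cos t`, and
`1/2 ≤ c ≤ √3/2` makes this at least `5/2`. -/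
lemma exists_chsh_angle {s a : ℝ} (hs : s ∈ Set.Ioc (2 : ℝ) (5 / 2)) (ha : 0 < a)
    (ha' : a ≤ Real.pi / 3) :
    ∃ t, 0 < t ∧ t ≤ (Real.pi - a) / 3 ∧
      Real.cos a + 2 * Real.cos t - Real.cos (a + 2 * t) = s := by
  set f : ℝ → ℝ := fun t => Real.cos a + 2 * Real.cos t - Real.cos (a + 2 * t) with hf
  have hpi := Real.pi_pos
  set u := (Real.pi - a) / 3 with hu
  have hu0 : 0 ≤ u := by linarith
  have f0 : f 0 = 2 := by simp [hf]
  have f1 : 5 / 2 ≤ f u := by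
    have e₁ : a = Real.pi - 3 * u := by rw [hu]; ring
    have e₂ : a + 2 * u = Real.pi - u := by rw [hu]; ring
    have c₁ : 1 / 2 ≤ Real.cos u := by
      rw [← Real.cos_pi_div_three]
      exact Real.cos_le_cos_of_nonneg_of_le_pi hu0 (by linarith) (by linarith)
    have c₂ : Real.cos u ≤ √3 / 2 := by
      rw [← Real.cos_pi_div_six]
      exact Real.cos_le_cos_of_nonneg_of_le_pi (by linarith) (by linarith) (by linarith)
    have c₃ : √3 < 1.75 := by
      rw [Real.sqrt_lt' (by norm_num)]; norm_num
    have : f u = 6 * Real.cos u - 4 * Real.cos u ^ 3 := by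
      simp only [hf]
      rw [e₂, Real.cos_pi_sub]
      conv_lhs => rw [e₁]
      rw [Real.cos_pi_sub, Real.cos_three_mul]
      ring
    rw [this]
    nlinarith [mul_nonneg (sub_nonneg.2 c₁) (sub_nonneg.2 (c₂.trans (by linarith : √3 / 2 ≤ 7 / 8)))]
  have hfc : ContinuousOn f (Set.Icc 0 u) := by fun_prop
  obtain ⟨t, ht, hts⟩ := intermediate_value_Icc hu0 hfc
    (show s ∈ Set.Icc (f 0) (f u) from ⟨by rw [f0]; exact hs.1.le, hs.2.trans f1⟩)
  refine ⟨t, lt_of_le_of_ne ht.1 ?_, ht.2, hts⟩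
  rintro rfl
  rw [f0] at hts
  exact hs.1.ne hts

/-- When `cos a` is close to `1` in terms of `s - 2`, the CHSH value `s` forces `a ≤ t`, because for
`t < a` it is at most `3 - cos (3a)`. -/
lemma le_of_chsh_eq {s a t : ℝ} (ha' : a ≤ Real.pi / 3) (ht : 0 < t)
    (hcos : 1 - (s - 2) / 18 ≤ Real.cos a) (hs : 2 < s)
    (h : Real.cos a + 2 * Real.cos t - Real.cos (a + 2 * t) = s) : a ≤ t := by
  by_contra! hlt
  have h₁ : Real.cos (3 * a) ≤ Real.cos (a + 2 * t) :=
    Real.cos_le_cos_of_nonneg_of_le_pi (by linarith) (by linarith) (by linarith)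
  rw [Real.cos_three_mul] at h₁
  have h₂ : 0 ≤ Real.cos a := Real.cos_nonneg_of_mem_Icc ⟨by linarith, by linarith [Real.pi_pos]⟩
  have h₃ := Real.cos_le_one a
  have h₄ := Real.cos_le_one t
  nlinarith [mul_nonneg h₂ (sq_nonneg (1 - Real.cos a)), sq_nonneg (1 - Real.cos a)]

/-- If `a ≤ t ≤ (π - a) / 3`, then no input pair has stronger correlations than `(0, 0)`. -/
lemma abs_optimalCorrelator_le {a t : ℝ} (ha : 0 < a) (hat : a ≤ t)
    (ht : t ≤ (Real.pi - a) / 3) (x y : Fin 2) :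
    |optimalCorrelator a t x y| ≤ Real.cos a := by
  have key {u : ℝ} (h₀ : a ≤ u) (h₁ : u ≤ Real.pi - a) : |Real.cos u| ≤ Real.cos a := by
    rw [abs_le, ← Real.cos_pi_sub]
    exact ⟨Real.cos_le_cos_of_nonneg_of_le_pi (by linarith) (by linarith) h₁,
      Real.cos_le_cos_of_nonneg_of_le_pi ha.le (by linarith) h₀⟩
  fin_cases x <;> fin_cases y
  · exact key le_rfl (by linarith)
  · exact key hat (by linarith)
  · exact key hat (by linarith)
  · exact key (by linarith) (by linarith)

end DIQKD

open DIQKD in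
theorem proposition3 (s : ℝ) (hs : s ∈ Set.Ioc (2 : ℝ) (5 / 2)) :
    ∃ ε₀ : ℝ, 0 < ε₀ ∧
      ∀ ε ∈ Set.Ioc (0 : ℝ) (2 - 3 / 4 * Real.logb 2 3),
        ∃ (θ φ ω : ℝ) (P : DIQKD.Behaviour),
          DIQKD.SignCondition θ φ ω ∧
          DIQKD.IsQuantum P ∧
          DIQKD.bellValue θ φ ω P = DIQKD.etaQ θ φ ω ∧
          DIQKD.chsh P = s ∧
          DIQKD.keyRateAt θ φ ω (DIQKD.etaQ θ φ ω) P 0 0 = 1 - ε ∧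
          1 - ε ≤ DIQKD.keyRateMax θ φ ω (DIQKD.etaQ θ φ ω) P ∧
          (ε ≤ ε₀ → DIQKD.keyRateMax θ φ ω (DIQKD.etaQ θ φ ω) P = 1 - ε) := by
  obtain ⟨hs₁, hs₂⟩ := hs
  have hE₀ : 1 - (s - 2) / 18 ∈ Set.Icc (0 : ℝ) 1 := ⟨by linarith, by linarith⟩
  refine ⟨biasEntropy (1 - (s - 2) / 18), ?_, fun ε hε => ?_⟩
  · rw [← biasEntropy_one]
    exact strictAntiOn_biasEntropy hE₀ (by simp) (by linarith)
  obtain ⟨E, hE, rfl⟩ : ∃ E ∈ Set.Icc (1 / 2 : ℝ) 1, biasEntropy E = ε :=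
    intermediate_value_Icc' (by norm_num) continuous_biasEntropy.continuousOn
      ⟨by rw [biasEntropy_one]; exact hε.1.le, by rw [biasEntropy_half]; exact hε.2⟩
  have hE1 : E < 1 := lt_of_le_of_ne hE.2 fun h => by
    rw [h, biasEntropy_one] at hε
    exact lt_irrefl _ hε.1
  obtain ⟨a, ha, ha', rfl⟩ : ∃ a, 0 < a ∧ a ≤ Real.pi / 3 ∧ Real.cos a = E := by
    refine ⟨Real.arccos E, Real.arccos_pos.2 hE1, ?_,
      Real.cos_arccos (by linarith [hE.1]) hE.2⟩
    rw [← Real.arccos_cos (x := Real.pi / 3) (by positivity) (by linarith [Real.pi_pos]),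
      Real.cos_pi_div_three]
    exact Real.arccos_le_arccos hE.1
  obtain ⟨t, ht, ht', hts⟩ := exists_chsh_angle ⟨hs₁, hs₂⟩ ha ha'
  have hat : a + 2 * t < Real.pi := by linarith [Real.pi_pos]
  have hrate := keyRateAt_params ha ht hat
  have hle : 1 - biasEntropy (Real.cos a) ≤ keyRateMax (-(a + t)) (Real.pi / 2 + a)
      (Real.pi / 2 - t) (etaQ (-(a + t)) (Real.pi / 2 + a) (Real.pi / 2 - t))
      (optimalStrategy a t).behaviour :=
    (hrate 0 0).symm.le.trans
      (Finset.le_sup' (f := fun i : Fin 2 × Fin 2 => keyRateAt _ _ _ _ _ i.1 i.2)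
        (Finset.mem_univ ((0, 0) : Fin 2 × Fin 2)))
  refine ⟨-(a + t), Real.pi / 2 + a, Real.pi / 2 - t, (optimalStrategy a t).behaviour,
    signCondition_params ha ht hat, ⟨_, rfl⟩, bellValue_optimalStrategy a t,
    (chsh_optimalStrategy a t).trans hts, hrate 0 0, hle, fun hsmall => le_antisymm ?_ hle⟩
  have hcos : 1 - (s - 2) / 18 ≤ Real.cos a :=
    (strictAntiOn_biasEntropy.le_iff_ge ⟨by linarith [hE.1], hE.2⟩ hE₀).1 hsmall
  have hat' := le_of_chsh_eq ha' ht hcos hs₁ hts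
  refine Finset.sup'_le _ _ fun i _ => ?_
  rw [hrate, ← biasEntropy_abs (optimalCorrelator a t i.1 i.2)]
  have habs := abs_optimalCorrelator_le ha hat' ht' i.1 i.2
  exact sub_le_sub_left (strictAntiOn_biasEntropy.antitoneOn
    ⟨abs_nonneg _, habs.trans hE.2⟩ ⟨by linarith [hE.1], hE.2⟩ habs) 1
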